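/- For a real number $a$ and an integer $s\ge 0$ write $(a)_s=a(a+1)\cdots(a+s-1)$ (with $(a)_0=1$), and let $L_n^\alpha(x)=\sum_{l=0}^n\binom{n+\alpha}{n-l}\frac{(-x)^l}{l!}$ denote the Laguerre polynomials. Let $\alpha>-1$, let $K\ge 1$ be an integer, and let $\tau_0,\dots,\tau_K$ be real numbers with $\tau_K\neq 0$. Assume that the polynomial $$R(x)=\sum_{j=0}^K\frac{\tau_j}{j!}(\alpha+1-x)_j$$ has only real zeros, and denote them, listed with multiplicity and in decreasing order, by $\zeta_1\ge\zeta_2\ge\dots\ge\zeta_K$. Put $$u_1=\max\{0,\lfloor-\zeta_{K-1}+1\rfloor\},\qquad u_0=\max\{0,\lfloor-\zeta_K+1\rfloor\},$$ where for $K=1$ (when there is no zero $\zeta_{K-1}$) the symbol $\zeta_0$ in the definition of $u_1$ may be any real number. Then the Laguerre expansion $$\sum_{j=0}^K\tau_j\,(j+1)_{u_l}(\alpha+j+1)_{u_l}L_j^\alpha(x)$$ has only real zeros for $l=1$, and all its zeros are real and positive for $l=0$. In particular, if $R$ has only positive zeros, then $u_0=0$ and all zeros of $\sum_{j=0}^K\tau_jL_j^\alpha(x)$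 are real and positive (the equal-parameter case of a result of Iserles and Saff). -/

import Mathlib

open Polynomial

noncomputable section

namespace LaguerreExpansion

/-- The Pochhammer symbol `(a)_s = a (a + 1) ⋯ (a + s - 1)`, with `(a)_0 = 1`. -/
def poch (a : ℝ) (s : ℕ) : ℝ := (ascPochhammer ℝ s).eval a

/-- The Laguerre polynomial
`L_n^α(x) = ∑_{l=0}^{n} binom(n + α, n - l) (-x)^l / l!`, in the standard normalization.
`Ring.choose` is the generalized binomial coefficient `a (a - 1) ⋯ (a - k + 1) / k!`. -/
def laguerre (α : ℝ) (n : ℕ) : ℝ[X] :=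
  ∑ l ∈ Finset.range (n + 1),
    C (Ring.choose ((n : ℝ) + α) (n - l) / (l.factorial : ℝ)) * (-X) ^ l

/-- The polynomial `R(x) = ∑_{j=0}^{K} τ_j / j! · (α + 1 - x)_j`. -/
def polyR (α : ℝ) (K : ℕ) (τ : ℕ → ℝ) : ℝ[X] :=
  ∑ j ∈ Finset.range (K + 1),
    C (τ j / (j.factorial : ℝ)) * (ascPochhammer ℝ j).comp (C (α + 1) - X)

/-- The Laguerre expansion `∑_{j=0}^{K} τ_j (j + 1)_u (α + j + 1)_u L_j^α(x)`. -/
def expansion (α : ℝ) (K : ℕ) (τ : ℕ → ℝ) (u : ℕ) : ℝ[X] :=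
  ∑ j ∈ Finset.range (K + 1),
    C (τ j * poch ((j : ℝ) + 1) u * poch (α + (j : ℝ) + 1) u) * laguerre α j

/-- The non-negative integer `max {0, ⌊-ζ + 1⌋}`. -/
def shift (ζ : ℝ) : ℕ := (max 0 ⌊-ζ + 1⌋).toNat

/-- All complex zeros of `p` are real. (The zero polynomial does not have this property.) -/
def HasOnlyRealZeros (p : ℝ[X]) : Prop :=
  ∀ z : ℂ, aeval z p = 0 → z.im = 0

/-- All complex zeros of `p` are real and positive. -/
def HasOnlyPositiveZeros (p : ℝ[X]) : Prop :=
  ∀ z : ℂ, aeval z p = 0 → z.im = 0 ∧ 0 < z.re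

end LaguerreExpansion

end

noncomputable section

namespace LaguerreExpansion

/-! ### Laguerre polynomials and first-order differential operators -/

/-! Put `θ = xD - x`. Since `(θ + b + 1 + n) L_n^b = (n + 1) L_{n+1}^b`, substituting `-θ` for `x`
in `(b + 1 - x)_n` and applying the result to `1` gives `n! L_n^b`. With `b = α + u`, the sum `∑ τ_j
L_j^{α+u}` is therefore `R(x - u)` at `-θ`, applied to `1`: up to a nonzero constant, a product of
the operators `θ + ζ_i + u` applied to `1` (`sum_laguerre_eq_raiseProd`).

Bounds on the logarithmic derivative show that `θ + a` with `a > 0` preserves positivity of zeros,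
and that for any real `a` it sends positive zeros to real ones. So positive `ζ_i + u` for all `i`
give positive zeros; if the last factor is uncontrolled, the zeros are still real.

The passage from `L_j^{α+u}` to `(j + 1)_u (α + j + 1)_u L_j^α` is made of first-order operators and
`u` derivatives (`eulerIter_derivative_raiseIter`), all of which preserve both properties because `α
> -1`. -/

lemma succ_mul_choose_succ (a : ℝ) (k : ℕ) :
    ((k : ℝ) + 1) * Ring.choose a (k + 1) = (a - k) * Ring.choose a k := by
  have hk : ((k.factorial : ℕ) : ℝ) ≠ 0 := by exact_mod_cast k.factorial_ne_zero
  have hk' : (k : ℝ) + 1 ≠ 0 := by positivity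
  rw [Ring.choose_eq_smul, Ring.choose_eq_smul, descPochhammer_succ_right, smeval_mul, smeval_sub,
    smeval_X, smeval_natCast, Nat.factorial_succ]
  simp only [smul_eq_mul, pow_zero, pow_one, nsmul_eq_mul, mul_one]
  push_cast
  field_simp

lemma sub_mul_choose (a : ℝ) (k : ℕ) :
    (a - k) * Ring.choose a k = a * Ring.choose (a - 1) k := by
  have h1 := succ_mul_choose_succ a k
  have h2 := succ_mul_choose_succ (a - 1) k
  have h3 := Ring.choose_succ_succ (a - 1) k
  rw [sub_add_cancel] at h3
  rw [h3] at h1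
  linear_combination -h1 + h2

lemma coeff_laguerre_of_le (α : ℝ) {n l : ℕ} (h : l ≤ n) :
    (laguerre α n).coeff l =
      (-1) ^ l / (l.factorial : ℝ) * Ring.choose ((n : ℝ) + α) (n - l) := by
  simp only [laguerre, finsetSum_coeff, neg_pow (X : ℝ[X]), ← C_1, ← C_neg, ← C_pow, ← mul_assoc,
    ← C_mul, coeff_C_mul, coeff_X_pow, mul_ite, mul_one, mul_zero]
  rw [Finset.sum_ite_eq, if_pos (Finset.mem_range.2 (by omega))]
  ring

lemma coeff_laguerre_of_lt (α : ℝ) {n l : ℕ} (h : n < l) : (laguerre α n).coeff l = 0 := by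
  simp only [laguerre, finsetSum_coeff, neg_pow (X : ℝ[X]), ← C_1, ← C_neg, ← C_pow, ← mul_assoc,
    ← C_mul, coeff_C_mul, coeff_X_pow, mul_ite, mul_one, mul_zero]
  rw [Finset.sum_ite_eq, if_neg (by simp; omega)]

lemma laguerre_zero (α : ℝ) : laguerre α 0 = 1 := by
  simp [laguerre]

/-- The operator `p ↦ x p' + a p`. -/
def eulerOp (a : ℝ) : ℝ[X] →ₗ[ℝ] ℝ[X] :=
  LinearMap.mulLeft ℝ X ∘ₗ derivative + a • LinearMap.id

/-- The operator `p ↦ x p' + (a - x) p`. -/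
def raiseOp (a : ℝ) : ℝ[X] →ₗ[ℝ] ℝ[X] :=
  eulerOp a - LinearMap.mulLeft ℝ X

lemma eulerOp_apply (a : ℝ) (p : ℝ[X]) : eulerOp a p = X * derivative p + C a * p := by
  simp [eulerOp, smul_eq_C_mul]

lemma raiseOp_apply (a : ℝ) (p : ℝ[X]) :
    raiseOp a p = X * derivative p + C a * p - X * p := by
  simp [raiseOp, eulerOp_apply]

lemma coeff_eulerOp (a : ℝ) (p : ℝ[X]) (l : ℕ) :
    (eulerOp a p).coeff l = (l + a) * p.coeff l := by
  rw [eulerOp_apply]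
  cases l with
  | zero => simp
  | succ l => simp [coeff_X_mul, coeff_derivative]; ring

lemma coeff_raiseOp_zero (a : ℝ) (p : ℝ[X]) :
    (raiseOp a p).coeff 0 = a * p.coeff 0 := by
  simp [raiseOp, coeff_eulerOp]

lemma coeff_raiseOp_succ (a : ℝ) (p : ℝ[X]) (l : ℕ) :
    (raiseOp a p).coeff (l + 1) = (l + 1 + a) * p.coeff (l + 1) - p.coeff l := by
  simp [raiseOp, coeff_eulerOp, coeff_X_mul]

lemma eulerOp_laguerre (a : ℝ) (n : ℕ) :
    eulerOp a (laguerre a n) = ((n : ℝ) + a) • laguerre (a - 1) n := by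
  ext l
  rw [coeff_eulerOp, coeff_smul, smul_eq_mul]
  rcases le_or_gt l n with h | h
  · rw [coeff_laguerre_of_le _ h, coeff_laguerre_of_le _ h]
    have := sub_mul_choose ((n : ℝ) + a) (n - l)
    rw [Nat.cast_sub h] at this
    rw [← add_sub_assoc]
    linear_combination (-1) ^ l / (l.factorial : ℝ) * this
  · rw [coeff_laguerre_of_lt _ h, coeff_laguerre_of_lt _ h, mul_zero, mul_zero]

lemma derivative_laguerre_succ (a : ℝ) (n : ℕ) :
    derivative (laguerre a (n + 1)) = -laguerre (a + 1) n := by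
  ext l
  rw [coeff_derivative, coeff_neg]
  rcases le_or_gt l n with h | h
  · rw [coeff_laguerre_of_le _ h, coeff_laguerre_of_le _ (by omega), Nat.add_sub_add_right,
      Nat.factorial_succ, pow_succ]
    have hl : ((l.factorial : ℕ) : ℝ) ≠ 0 := by exact_mod_cast l.factorial_ne_zero
    have hl' : (l : ℝ) + 1 ≠ 0 := by positivity
    push_cast
    rw [add_assoc (n : ℝ), add_comm 1 a]
    field_simp
  · rw [coeff_laguerre_of_lt _ h, coeff_laguerre_of_lt _ (by omega), zero_mul, neg_zero]

/-- A coefficient comparison shared by the two raising identities. -/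
lemma coeff_raiseOp_laguerre (a c : ℝ) (n l : ℕ) (hl : l ≤ n) :
    (raiseOp c (laguerre a n)).coeff l = (-1) ^ l / (l.factorial : ℝ) *
      ((l + c) * Ring.choose ((n : ℝ) + a) (n - l)
        + l * Ring.choose ((n : ℝ) + a) (n - l + 1)) := by
  cases l with
  | zero => simp [coeff_raiseOp_zero, coeff_laguerre_of_le]
  | succ l =>
    rw [coeff_raiseOp_succ, coeff_laguerre_of_le _ hl, coeff_laguerre_of_le _ (by omega),
      show n - (l + 1) + 1 = n - l by omega, Nat.factorial_succ, pow_succ]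
    have h : ((l.factorial : ℕ) : ℝ) ≠ 0 := by exact_mod_cast l.factorial_ne_zero
    have h' : (l : ℝ) + 1 ≠ 0 := by positivity
    push_cast
    field_simp
    ring

/-- Above degree `n` only the coefficient of `x^(n+1)` survives, and it depends on none of the
parameters; hence `a`, `b`, `c` are unrelated. -/
lemma coeff_raiseOp_laguerre_of_lt (a b c : ℝ) {n l : ℕ} (hl : n < l) :
    (raiseOp c (laguerre a n)).coeff l = ((n : ℝ) + 1) * (laguerre b (n + 1)).coeff l := by
  cases l with
  | zero => omega
  | succ l =>
    rw [coeff_raiseOp_succ, coeff_laguerre_of_lt _ hl]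
    rcases (Nat.lt_succ_iff.1 hl).eq_or_lt with rfl | h
    · rw [coeff_laguerre_of_le _ le_rfl, coeff_laguerre_of_le _ le_rfl, Nat.factorial_succ,
        pow_succ]
      have h : ((n.factorial : ℕ) : ℝ) ≠ 0 := by exact_mod_cast n.factorial_ne_zero
      have h' : (n : ℝ) + 1 ≠ 0 := by positivity
      simp
      field_simp
    · rw [coeff_laguerre_of_lt _ h, coeff_laguerre_of_lt _ (by omega)]
      simp

lemma raiseOp_laguerre (a : ℝ) (n : ℕ) :
    raiseOp a (laguerre a n) = ((n : ℝ) + 1) • laguerre (a - 1) (n + 1) := by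
  ext l
  rw [coeff_smul, smul_eq_mul]
  rcases le_or_gt l n with h | h
  · rw [coeff_raiseOp_laguerre _ _ _ _ h, coeff_laguerre_of_le _ (by omega : l ≤ n + 1),
      show n + 1 - l = n - l + 1 by omega]
    have := succ_mul_choose_succ ((n : ℝ) + a) (n - l)
    rw [Nat.cast_sub h] at this
    rw [show ((n + 1 : ℕ) : ℝ) + (a - 1) = n + a by push_cast; ring]
    linear_combination -(-1) ^ l / (l.factorial : ℝ) * this
  · exact coeff_raiseOp_laguerre_of_lt _ _ _ h

/-- The constant grows with `n` so that the parameter stays fixed; these are the successive factors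
of the Pochhammer symbols in `R`. -/
lemma raiseOp_add_laguerre (a : ℝ) (n : ℕ) :
    raiseOp (a + 1 + n) (laguerre a n) = ((n : ℝ) + 1) • laguerre a (n + 1) := by
  ext l
  rw [coeff_smul, smul_eq_mul]
  rcases le_or_gt l n with h | h
  · rw [coeff_raiseOp_laguerre _ _ _ _ h, coeff_laguerre_of_le _ (by omega : l ≤ n + 1),
      show n + 1 - l = n - l + 1 by omega]
    have := succ_mul_choose_succ ((n : ℝ) + a) (n - l)
    rw [Nat.cast_sub h] at this
    rw [show ((n + 1 : ℕ) : ℝ) + a = n + a + 1 by push_cast; ring, Ring.choose_succ_succ]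
    linear_combination -(-1) ^ l / (l.factorial : ℝ) * this
  · exact coeff_raiseOp_laguerre_of_lt _ _ _ h

/-! ### Laguerre expansions as products of raising operators -/

lemma aeval_ascPochhammer_one (b : ℝ) (n : ℕ) :
    aeval (-raiseOp 0) ((ascPochhammer ℝ n).comp (C (b + 1) - X)) (1 : ℝ[X]) =
      (n.factorial : ℝ) • laguerre b n := by
  induction n with
  | zero => simp [laguerre_zero]
  | succ n ih =>
    rw [ascPochhammer_succ_right, mul_comp, mul_comm, map_mul, Module.End.mul_apply, ih, map_smul,
      Nat.factorial_succ, mul_comm (n + 1), Nat.cast_mul, mul_smul]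
    congr 1
    push_cast
    rw [← raiseOp_add_laguerre]
    simp [raiseOp_apply, Algebra.algebraMap_eq_smul_one, smul_eq_C_mul,
      Module.End.natCast_apply]
    ring

lemma aeval_polyR_one (b : ℝ) (K : ℕ) (τ : ℕ → ℝ) :
    aeval (-raiseOp 0) (polyR b K τ) (1 : ℝ[X]) =
      ∑ j ∈ Finset.range (K + 1), τ j • laguerre b j := by
  simp only [polyR, map_sum, LinearMap.sum_apply]
  refine Finset.sum_congr rfl fun j _ => ?_
  rw [map_mul, aeval_C, Algebra.algebraMap_eq_smul_one, smul_mul_assoc, one_mul,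
    LinearMap.smul_apply, aeval_ascPochhammer_one, smul_smul,
    div_mul_cancel₀ _ (by exact_mod_cast j.factorial_ne_zero)]

/-- Raising the parameter by `u` translates every zero of `R` by `u`, which is how the shift makes
zeros positive. -/
lemma polyR_comp_X_sub_C (α : ℝ) (K : ℕ) (τ : ℕ → ℝ) (u : ℕ) :
    (polyR α K τ).comp (X - C (u : ℝ)) = polyR (α + u) K τ := by
  simp only [polyR, Polynomial.sum_comp, mul_comp, C_comp, comp_assoc, sub_comp, X_comp]
  refine Finset.sum_congr rfl fun j _ => ?_
  congr 2
  simp only [C_add]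
  ring

lemma natDegree_polyR_le (α : ℝ) (K : ℕ) (τ : ℕ → ℝ) : (polyR α K τ).natDegree ≤ K := by
  refine natDegree_sum_le_of_forall_le _ _ fun j hj => (natDegree_C_mul_le _ _).trans ?_
  refine natDegree_comp_le.trans ?_
  rw [ascPochhammer_natDegree]
  have h : (C (α + 1) - X : ℝ[X]).natDegree ≤ 1 := by compute_degree
  calc j * _ ≤ j * 1 := Nat.mul_le_mul_left _ h
    _ ≤ K := by simpa using Nat.lt_succ_iff.1 (Finset.mem_range.1 hj)

/-- The polynomial `(-1)^k (xD + ζ_1 - x) ⋯ (xD + ζ_k - x) 1`. -/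
def raiseProd (ζ : ℕ → ℝ) : ℕ → ℝ[X]
  | 0 => 1
  | k + 1 => -raiseOp (ζ (k + 1)) (raiseProd ζ k)

lemma aeval_prod_one (ζ : ℕ → ℝ) (k : ℕ) :
    aeval (-raiseOp 0) (∏ i ∈ Finset.Icc 1 k, (X - C (ζ i))) (1 : ℝ[X]) = raiseProd ζ k := by
  induction k with
  | zero => simp [raiseProd]
  | succ k ih =>
    rw [Finset.prod_Icc_succ_top (by omega), mul_comm, map_mul, Module.End.mul_apply, ih,
      raiseProd]
    simp [raiseOp_apply, Algebra.algebraMap_eq_smul_one, smul_eq_C_mul]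
    ring

lemma sum_laguerre_eq_raiseProd (α : ℝ) {K : ℕ} (hK : 1 ≤ K) (τ ζ : ℕ → ℝ)
    (hroots : (polyR α K τ).roots = (Finset.Icc 1 K).val.map ζ) (u : ℕ) :
    ∃ c : ℝ, c ≠ 0 ∧ ∑ j ∈ Finset.range (K + 1), τ j • laguerre (α + u) j =
      c • raiseProd (fun i => ζ i + u) K := by
  have hcard : Multiset.card (polyR α K τ).roots = K := by simp [hroots]
  have hne : polyR α K τ ≠ 0 := by
    intro h
    rw [h] at hcard
    simp at hcard
    omega
  -- `K` roots against degree at most `K`: `R` splits over the reals.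
  have hdeg : Multiset.card (polyR α K τ).roots = (polyR α K τ).natDegree :=
    le_antisymm (card_roots' _) (hcard.symm ▸ natDegree_polyR_le α K τ)
  have hprod := C_leadingCoeff_mul_prod_multiset_X_sub_C hdeg
  rw [hroots, Multiset.map_map] at hprod
  refine ⟨(polyR α K τ).leadingCoeff, leadingCoeff_ne_zero.2 hne, ?_⟩
  rw [← aeval_polyR_one, ← polyR_comp_X_sub_C, ← aeval_prod_one]
  nth_rewrite 1 [← hprod]
  change aeval (-raiseOp 0) ((C _ * ∏ i ∈ Finset.Icc 1 K, (X - C (ζ i))).comp _) 1 = _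
  rw [mul_comp, C_comp, map_mul, aeval_C, Algebra.algebraMap_eq_smul_one, smul_mul_assoc, one_mul,
    LinearMap.smul_apply, prod_comp]
  congr 4
  ext1 i
  simp only [sub_comp, X_comp, C_comp, C_add]
  ring

/-! ### Passing to the coefficients `(j + 1)_u (α + j + 1)_u` -/

lemma poch_zero (a : ℝ) : poch a 0 = 1 := by simp [poch]

lemma poch_succ (a : ℝ) (s : ℕ) : poch a (s + 1) = poch a s * (a + s) :=
  ascPochhammer_succ_eval s a

lemma poch_succ_left (a : ℝ) (s : ℕ) : poch a (s + 1) = a * poch (a + 1) s := by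
  simp [poch, ascPochhammer_succ_left]

/-- The operator `(xD + a + 1 - x) ⋯ (xD + a + u - x)`. -/
def raiseIter (a : ℝ) : ℕ → ℝ[X] →ₗ[ℝ] ℝ[X]
  | 0 => LinearMap.id
  | u + 1 => raiseIter a u ∘ₗ raiseOp (a + (u + 1 : ℕ))

/-- The operator `(xD + a + 1) ⋯ (xD + a + u)`. -/
def eulerIter (a : ℝ) : ℕ → ℝ[X] →ₗ[ℝ] ℝ[X]
  | 0 => LinearMap.id
  | u + 1 => eulerIter a u ∘ₗ eulerOp (a + (u + 1 : ℕ))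

lemma raiseIter_laguerre (a : ℝ) (u n : ℕ) :
    raiseIter a u (laguerre (a + u) n) = poch ((n : ℝ) + 1) u • laguerre a (n + u) := by
  induction u generalizing n with
  | zero => simp [raiseIter, poch_zero]
  | succ u ih =>
    rw [raiseIter, LinearMap.comp_apply, raiseOp_laguerre, map_smul,
      show a + ((u + 1 : ℕ) : ℝ) - 1 = a + u by push_cast; ring, ih, smul_smul, poch_succ_left]
    push_cast
    rw [show n + 1 + u = n + (u + 1) by ring]

lemma eulerIter_laguerre (a : ℝ) (u n : ℕ) :
    eulerIter a u (laguerre (a + u) n) = poch (a + n + 1) u • laguerre a n := by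
  induction u with
  | zero => simp [eulerIter, poch_zero]
  | succ u ih =>
    rw [eulerIter, LinearMap.comp_apply, eulerOp_laguerre, map_smul,
      show a + ((u + 1 : ℕ) : ℝ) - 1 = a + u by push_cast; ring, ih, smul_smul, poch_succ]
    congr 1
    push_cast
    ring

lemma iterate_derivative_laguerre (a : ℝ) (u n : ℕ) :
    derivative^[u] (laguerre a (n + u)) = (-1 : ℝ) ^ u • laguerre (a + u) n := by
  induction u generalizing a with
  | zero => simp
  | succ u ih =>
    rw [Function.iterate_succ_apply, ← add_assoc, derivative_laguerre_succ,
      iterate_derivative_neg, ih, pow_succ, mul_neg_one, neg_smul]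
    push_cast
    rw [add_right_comm a 1, add_assoc a]

/-- On each `L_j^{α+u}`, `raiseIter` contributes `(j + 1)_u` and moves to `L_{j+u}^α`, the
derivatives return to `L_j^{α+u}` with sign `(-1)^u`, and `eulerIter` contributes `(α + j + 1)_u`.
-/
lemma eulerIter_derivative_raiseIter (α : ℝ) (K : ℕ) (τ : ℕ → ℝ) (u : ℕ) :
    eulerIter α u (derivative^[u] (raiseIter α u
      (∑ j ∈ Finset.range (K + 1), τ j • laguerre (α + u) j))) =
      (-1 : ℝ) ^ u • expansion α K τ u := by
  rw [expansion, map_sum, iterate_derivative_sum, map_sum, Finset.smul_sum]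
  refine Finset.sum_congr rfl fun j _ => ?_
  rw [map_smul, raiseIter_laguerre, iterate_derivative_smul, iterate_derivative_smul,
    iterate_derivative_laguerre, map_smul, map_smul, map_smul, eulerIter_laguerre,
    ← smul_eq_C_mul, smul_smul, smul_smul, smul_smul, smul_smul]
  congr 1
  rw [show α + j + 1 = α + (j : ℝ) + 1 from rfl]
  ring

end LaguerreExpansion

end
noncomputable section

namespace LaguerreExpansion

/-! ### Preservation of real and of positive zeros -/

lemma HasOnlyRealZeros.ne_zero {p : ℝ[X]} (hp : HasOnlyRealZeros p) : p ≠ 0 := by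
  rintro rfl
  simpa using hp Complex.I (by simp)

lemma HasOnlyPositiveZeros.hasOnlyRealZeros {p : ℝ[X]} (hp : HasOnlyPositiveZeros p) :
    HasOnlyRealZeros p := fun z hz => (hp z hz).1

lemma hasOnlyPositiveZeros_one : HasOnlyPositiveZeros (1 : ℝ[X]) := fun z hz => by
  simp at hz

lemma hasOnlyRealZeros_smul {c : ℝ} (hc : c ≠ 0) {p : ℝ[X]} :
    HasOnlyRealZeros (c • p) ↔ HasOnlyRealZeros p := by
  simp [HasOnlyRealZeros, hc]

lemma hasOnlyPositiveZeros_smul {c : ℝ} (hc : c ≠ 0) {p : ℝ[X]} :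
    HasOnlyPositiveZeros (c • p) ↔ HasOnlyPositiveZeros p := by
  simp [HasOnlyPositiveZeros, hc]

/-- The sum of `1 / (z - r)` over the complex zeros `r` of `p`. -/
def zeroSum (p : ℝ[X]) (z : ℂ) : ℂ :=
  ((p.map (algebraMap ℝ ℂ)).roots.map fun r => 1 / (z - r)).sum

lemma aeval_derivative_eq (p : ℝ[X]) {z : ℂ} (hz : aeval z p ≠ 0) :
    aeval z (derivative p) = aeval z p * zeroSum p z := by
  have h := (IsAlgClosed.splits (p.map (algebraMap ℝ ℂ))).eval_derivative_eq_eval_mul_sum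
    (x := z) (by rwa [eval_map_algebraMap])
  rwa [derivative_map, eval_map_algebraMap, eval_map_algebraMap] at h

lemma aeval_eq_zero_of_mem_roots {p : ℝ[X]} {r : ℂ}
    (hr : r ∈ (p.map (algebraMap ℝ ℂ)).roots) : aeval r p = 0 := by
  rw [← eval_map_algebraMap]
  exact (mem_roots'.1 hr).2

lemma map_roots_ne_empty {p : ℝ[X]} (hp : p.natDegree ≠ 0) (f : ℂ → ℂ) :
    (p.map (algebraMap ℝ ℂ)).roots.map f ≠ ∅ := by
  intro h
  rw [Multiset.empty_eq_zero, Multiset.map_eq_zero] at h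
  have := (IsAlgClosed.splits (p.map (algebraMap ℝ ℂ))).natDegree_eq_card_roots
  rw [h, natDegree_map] at this
  exact hp (by simpa using this)

lemma im_mul_im_one_div_neg {z r : ℂ} (hz : z.im ≠ 0) (hr : r.im = 0) :
    z.im * (1 / (z - r)).im < 0 := by
  have hw : 0 < Complex.normSq (z - r) := by
    refine Complex.normSq_pos.2 fun h => hz ?_
    rw [sub_eq_zero.1 h, hr]
  rw [one_div, Complex.inv_im, Complex.sub_im, hr, sub_zero, mul_div_assoc', mul_neg]
  exact div_neg_of_neg_of_pos (neg_neg_of_pos (mul_self_pos.2 hz)) hw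

lemma im_mul_im_zeroSum_neg {p : ℝ[X]} (hp : HasOnlyRealZeros p) (hd : p.natDegree ≠ 0) {z : ℂ}
    (hz : z.im ≠ 0) : z.im * (zeroSum p z).im < 0 := by
  refine Multiset.sum_induction_nonempty (fun w : ℂ => z.im * w.im < 0) ?_
    (map_roots_ne_empty hd _) ?_
  · intro a b ha hb
    rw [Complex.add_im, mul_add]
    exact add_neg ha hb
  · simp only [Multiset.mem_map, forall_exists_index, and_imp, forall_apply_eq_imp_iff₂]
    exact fun r hr => im_mul_im_one_div_neg hz (hp r (aeval_eq_zero_of_mem_roots hr))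

lemma im_mul_im_zeroSum_nonpos {p : ℝ[X]} (hp : HasOnlyRealZeros p) {z : ℂ}
    (hz : z.im ≠ 0) : z.im * (zeroSum p z).im ≤ 0 := by
  refine Multiset.sum_induction (fun w : ℂ => z.im * w.im ≤ 0) _ ?_ (by simp) ?_
  · intro a b ha hb
    rw [Complex.add_im, mul_add]
    exact add_nonpos ha hb
  · simp only [Multiset.mem_map, forall_exists_index, and_imp, forall_apply_eq_imp_iff₂]
    exact fun r hr => (im_mul_im_one_div_neg hz (hp r (aeval_eq_zero_of_mem_roots hr))).le

lemma im_mul_im_mul_zeroSum_nonpos {p : ℝ[X]} (hp : HasOnlyPositiveZeros p) {z : ℂ}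
    (hz : z.im ≠ 0) : z.im * (z * zeroSum p z).im ≤ 0 := by
  rw [zeroSum, ← Multiset.sum_map_mul_left]
  refine Multiset.sum_induction (fun w : ℂ => z.im * w.im ≤ 0) _ ?_ (by simp) ?_
  · intro a b ha hb
    rw [Complex.add_im, mul_add]
    exact add_nonpos ha hb
  · simp only [Multiset.mem_map, forall_exists_index, and_imp, forall_apply_eq_imp_iff₂]
    intro r hr
    obtain ⟨hi, hpos⟩ := hp r (aeval_eq_zero_of_mem_roots hr)
    have hne : z - r ≠ 0 := fun h => hz (by rw [sub_eq_zero.1 h, hi])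
    -- Positivity of `r` preserves the sign of the imaginary part in `z/(z - r) = 1 + r/(z - r)`.
    have h1 : z * (1 / (z - r)) = 1 + (r.re : ℂ) * (1 / (z - r)) := by
      rw [show (r.re : ℂ) = r from Complex.ext rfl (by simp [hi])]
      field_simp
      ring
    rw [h1, Complex.add_im, Complex.one_im, zero_add, Complex.im_ofReal_mul, ← mul_assoc,
      mul_comm z.im, mul_assoc]
    exact mul_nonpos_of_nonneg_of_nonpos hpos.le (im_mul_im_one_div_neg hz hi).le

lemma re_one_div_neg {z r : ℂ} (hz : z.re ≤ 0) (hr : 0 < r.re) : (1 / (z - r)).re < 0 := by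
  have h : (z - r).re < 0 := by rw [Complex.sub_re]; linarith
  rw [one_div, Complex.inv_re]
  refine div_neg_of_neg_of_pos h (Complex.normSq_pos.2 fun h0 => ?_)
  rw [h0] at h
  exact lt_irrefl _ h

lemma re_zeroSum_neg {p : ℝ[X]} (hp : HasOnlyPositiveZeros p) (hd : p.natDegree ≠ 0) {z : ℂ}
    (hz : z.re ≤ 0) : (zeroSum p z).re < 0 := by
  refine Multiset.sum_induction_nonempty (fun w : ℂ => w.re < 0)
    (fun a b ha hb => by simpa using add_neg ha hb) (map_roots_ne_empty hd _) ?_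
  simp only [Multiset.mem_map, forall_exists_index, and_imp, forall_apply_eq_imp_iff₂]
  exact fun r hr => re_one_div_neg hz (hp r (aeval_eq_zero_of_mem_roots hr)).2

lemma re_zeroSum_nonpos {p : ℝ[X]} (hp : HasOnlyPositiveZeros p) {z : ℂ}
    (hz : z.re ≤ 0) : (zeroSum p z).re ≤ 0 := by
  refine Multiset.sum_induction (fun w : ℂ => w.re ≤ 0) _
    (fun a b ha hb => by simpa using add_nonpos ha hb) (by simp) ?_
  simp only [Multiset.mem_map, forall_exists_index, and_imp, forall_apply_eq_imp_iff₂]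
  exact fun r hr => (re_one_div_neg hz (hp r (aeval_eq_zero_of_mem_roots hr)).2).le

/-- Off the real axis every term of `p'/p = ∑ 1/(z - r)` has imaginary part of sign opposite to `Im
z`, so the sum cannot vanish. -/
lemma HasOnlyRealZeros.derivative {p : ℝ[X]} (hp : HasOnlyRealZeros p) (hd : p.natDegree ≠ 0) :
    HasOnlyRealZeros (Polynomial.derivative p) := by
  intro z h
  by_contra hz
  have h0 : aeval z p ≠ 0 := fun h0 => hz (hp z h0)
  rw [aeval_derivative_eq p h0, mul_eq_zero, or_iff_right h0] at h
  simpa [h] using im_mul_im_zeroSum_neg hp hd hz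

lemma HasOnlyPositiveZeros.derivative {p : ℝ[X]} (hp : HasOnlyPositiveZeros p)
    (hd : p.natDegree ≠ 0) : HasOnlyPositiveZeros (Polynomial.derivative p) := by
  intro z h
  refine ⟨hp.hasOnlyRealZeros.derivative hd z h, ?_⟩
  by_contra! hz
  have h0 : aeval z p ≠ 0 := fun h0 => hz.not_gt (hp z h0).2
  rw [aeval_derivative_eq p h0, mul_eq_zero, or_iff_right h0] at h
  simpa [h] using re_zeroSum_neg hp hd hz

/-- `x p' + (a - e x) p` keeps only real zeros, for `a > 0` and real `e`. -/
lemma HasOnlyRealZeros.of_firstOrder {p q : ℝ[X]} (hp : HasOnlyRealZeros p) {a e : ℝ} (ha : 0 < a)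
    (hq : q = X * Polynomial.derivative p + C a * p - C e * X * p) : HasOnlyRealZeros q := by
  intro z h
  by_contra hz
  have h0 : aeval z p ≠ 0 := fun h0 => hz (hp z h0)
  have hz0 : z ≠ 0 := by rintro rfl; simp at hz
  -- Dividing by `z p`, the term `a/z` acts like an extra zero at the origin of weight `a`.
  have h1 : aeval z p * z * (zeroSum p z + (a : ℂ) * (1 / (z - 0)) - e) = 0 := by
    rw [sub_zero, ← h, hq]
    simp only [map_sub, map_add, map_mul, aeval_X, aeval_C, aeval_derivative_eq p h0,
      Complex.coe_algebraMap]
    linear_combination aeval z p * a * (mul_one_div_cancel hz0)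
  rw [mul_eq_zero, or_iff_right (mul_ne_zero h0 hz0)] at h1
  have h2 := congrArg (fun w : ℂ => z.im * w.im) h1
  simp only [Complex.sub_im, Complex.add_im, Complex.im_ofReal_mul, Complex.ofReal_im,
    Complex.zero_im, mul_zero, sub_zero (G := ℝ), mul_add] at h2
  have h3 := im_mul_im_zeroSum_nonpos hp hz
  have h4 := mul_neg_of_pos_of_neg ha (im_mul_im_one_div_neg hz Complex.zero_im)
  linarith

lemma HasOnlyPositiveZeros.of_firstOrder {p q : ℝ[X]} (hp : HasOnlyPositiveZeros p) {a e : ℝ}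
    (ha : 0 < a) (he : 0 ≤ e)
    (hq : q = X * Polynomial.derivative p + C a * p - C e * X * p) : HasOnlyPositiveZeros q := by
  intro z h
  have hi := hp.hasOnlyRealZeros.of_firstOrder ha hq z h
  refine ⟨hi, ?_⟩
  by_contra! hz
  have h0 : aeval z p ≠ 0 := fun h0 => hz.not_gt (hp z h0).2
  -- At the origin `q(0) = a p(0) ≠ 0`.
  have hz0 : z ≠ 0 := by
    rintro rfl
    rw [hq] at h
    simp [ha.ne', h0] at h
  have hre : z.re < 0 := lt_of_le_of_ne hz fun hr => hz0 (Complex.ext hr hi)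
  have h1 : aeval z p * z * (zeroSum p z + (a : ℂ) * (1 / z) - e) = 0 := by
    rw [← h, hq]
    simp only [map_sub, map_add, map_mul, aeval_X, aeval_C, aeval_derivative_eq p h0,
      Complex.coe_algebraMap]
    linear_combination aeval z p * a * (mul_one_div_cancel hz0)
  rw [mul_eq_zero, or_iff_right (mul_ne_zero h0 hz0)] at h1
  have h2 := congrArg Complex.re h1
  simp only [Complex.sub_re, Complex.add_re, Complex.re_ofReal_mul, Complex.ofReal_re,
    Complex.zero_re] at h2
  have h3 := re_zeroSum_nonpos hp hz
  have h4 : (1 / z).re < 0 := by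
    rw [one_div, Complex.inv_re]
    exact div_neg_of_neg_of_pos hre (Complex.normSq_pos.2 hz0)
  have h5 := mul_neg_of_pos_of_neg ha h4
  linarith

lemma HasOnlyRealZeros.eulerOp {p : ℝ[X]} (hp : HasOnlyRealZeros p) {a : ℝ} (ha : 0 < a) :
    HasOnlyRealZeros (eulerOp a p) :=
  hp.of_firstOrder (e := 0) ha (by simp [eulerOp_apply])

lemma HasOnlyPositiveZeros.eulerOp {p : ℝ[X]} (hp : HasOnlyPositiveZeros p) {a : ℝ} (ha : 0 < a) :
    HasOnlyPositiveZeros (eulerOp a p) :=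
  hp.of_firstOrder (e := 0) ha le_rfl (by simp [eulerOp_apply])

lemma HasOnlyRealZeros.raiseOp {p : ℝ[X]} (hp : HasOnlyRealZeros p) {a : ℝ} (ha : 0 < a) :
    HasOnlyRealZeros (raiseOp a p) :=
  hp.of_firstOrder (e := 1) ha (by simp [raiseOp_apply])

lemma HasOnlyPositiveZeros.raiseOp {p : ℝ[X]} (hp : HasOnlyPositiveZeros p) {a : ℝ} (ha : 0 < a) :
    HasOnlyPositiveZeros (raiseOp a p) :=
  hp.of_firstOrder (e := 1) ha zero_le_one (by simp [raiseOp_apply])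

/-- For arbitrary real `a`, `x p' + (a - x) p` has only real zeros if those of `p` are positive. -/
lemma HasOnlyPositiveZeros.hasOnlyRealZeros_raiseOp {p : ℝ[X]} (hp : HasOnlyPositiveZeros p)
    (a : ℝ) : HasOnlyRealZeros (LaguerreExpansion.raiseOp a p) := by
  intro z h
  by_contra hz
  have h0 : aeval z p ≠ 0 := fun h0 => hz (hp z h0).1
  -- Dividing by `p` alone leaves `a` real, so its sign is irrelevant; strictness comes from `-z`.
  have h1 : aeval z p * (z * zeroSum p z + a - z) = 0 := by
    rw [← h, raiseOp_apply]
    simp only [map_sub, map_add, map_mul, aeval_X, aeval_C, aeval_derivative_eq p h0,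
      Complex.coe_algebraMap]
    ring
  rw [mul_eq_zero, or_iff_right h0] at h1
  have h2 := congrArg (fun w : ℂ => z.im * w.im) h1
  simp only [Complex.sub_im, Complex.add_im, Complex.ofReal_im, Complex.zero_im, mul_zero,
    add_zero, mul_sub] at h2
  have h3 := im_mul_im_mul_zeroSum_nonpos hp hz
  have h4 := mul_self_pos.2 hz
  linarith

/-! ### Iterated operators and degree bounds -/

lemma natDegree_lt_natDegree_raiseOp (a : ℝ) {p : ℝ[X]} (hp : p ≠ 0) :
    p.natDegree < (raiseOp a p).natDegree := by
  refine Nat.succ_le_iff.1 (le_natDegree_of_ne_zero ?_)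
  rw [Nat.succ_eq_add_one, coeff_raiseOp_succ, coeff_natDegree,
    coeff_eq_zero_of_natDegree_lt (Nat.lt_succ_self _)]
  simpa using hp

/-- The degree gain of `u` ensures that the `u` derivatives taken afterwards never differentiate a
constant to zero. -/
lemma hasOnlyRealZeros_raiseIter {α : ℝ} (hα : -1 < α) (u : ℕ) {p : ℝ[X]}
    (hp : HasOnlyRealZeros p) :
    HasOnlyRealZeros (raiseIter α u p) ∧ p.natDegree + u ≤ (raiseIter α u p).natDegree := by
  induction u generalizing p with
  | zero => exact ⟨hp, le_rfl⟩
  | succ u ih =>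
    have h : 0 < α + ((u + 1 : ℕ) : ℝ) := by push_cast; linarith [u.cast_nonneg (α := ℝ)]
    obtain ⟨h1, h2⟩ := ih (hp.raiseOp h)
    have h3 := natDegree_lt_natDegree_raiseOp (α + ((u + 1 : ℕ) : ℝ)) hp.ne_zero
    exact ⟨h1, le_trans (by omega) h2⟩

lemma hasOnlyPositiveZeros_raiseIter {α : ℝ} (hα : -1 < α) (u : ℕ) {p : ℝ[X]}
    (hp : HasOnlyPositiveZeros p) : HasOnlyPositiveZeros (raiseIter α u p) := by
  induction u generalizing p with
  | zero => exact hp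
  | succ u ih =>
    exact ih (hp.raiseOp (by push_cast; linarith [u.cast_nonneg (α := ℝ)]))

lemma hasOnlyRealZeros_eulerIter {α : ℝ} (hα : -1 < α) (u : ℕ) {p : ℝ[X]}
    (hp : HasOnlyRealZeros p) : HasOnlyRealZeros (eulerIter α u p) := by
  induction u generalizing p with
  | zero => exact hp
  | succ u ih =>
    exact ih (hp.eulerOp (by push_cast; linarith [u.cast_nonneg (α := ℝ)]))

lemma hasOnlyPositiveZeros_eulerIter {α : ℝ} (hα : -1 < α) (u : ℕ) {p : ℝ[X]}
    (hp : HasOnlyPositiveZeros p) : HasOnlyPositiveZeros (eulerIter α u p) := by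
  induction u generalizing p with
  | zero => exact hp
  | succ u ih =>
    exact ih (hp.eulerOp (by push_cast; linarith [u.cast_nonneg (α := ℝ)]))

lemma HasOnlyRealZeros.iterate_derivative (u : ℕ) {p : ℝ[X]} (hp : HasOnlyRealZeros p)
    (hd : u ≤ p.natDegree) : HasOnlyRealZeros (Polynomial.derivative^[u] p) := by
  induction u generalizing p with
  | zero => exact hp
  | succ u ih =>
    refine ih (hp.derivative (by omega)) ?_
    rw [natDegree_derivative]
    omega

lemma HasOnlyPositiveZeros.iterate_derivative (u : ℕ) {p : ℝ[X]} (hp : HasOnlyPositiveZeros p)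
    (hd : u ≤ p.natDegree) : HasOnlyPositiveZeros (Polynomial.derivative^[u] p) := by
  induction u generalizing p with
  | zero => exact hp
  | succ u ih =>
    refine ih (hp.derivative (by omega)) ?_
    rw [natDegree_derivative]
    omega

lemma hasOnlyRealZeros_expansion {α : ℝ} (hα : -1 < α) (K : ℕ) (τ : ℕ → ℝ) (u : ℕ)
    (h : HasOnlyRealZeros (∑ j ∈ Finset.range (K + 1), τ j • laguerre (α + u) j)) :
    HasOnlyRealZeros (expansion α K τ u) := by
  rw [← hasOnlyRealZeros_smul (pow_ne_zero u (neg_ne_zero.2 one_ne_zero)),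
    ← eulerIter_derivative_raiseIter]
  obtain ⟨h1, h2⟩ := hasOnlyRealZeros_raiseIter hα u h
  exact hasOnlyRealZeros_eulerIter hα u (h1.iterate_derivative u (by omega))

lemma hasOnlyPositiveZeros_expansion {α : ℝ} (hα : -1 < α) (K : ℕ) (τ : ℕ → ℝ) (u : ℕ)
    (h : HasOnlyPositiveZeros (∑ j ∈ Finset.range (K + 1), τ j • laguerre (α + u) j)) :
    HasOnlyPositiveZeros (expansion α K τ u) := by
  rw [← hasOnlyPositiveZeros_smul (pow_ne_zero u (neg_ne_zero.2 one_ne_zero)),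
    ← eulerIter_derivative_raiseIter]
  have h2 := (hasOnlyRealZeros_raiseIter hα u h.hasOnlyRealZeros).2
  exact hasOnlyPositiveZeros_eulerIter hα u
    ((hasOnlyPositiveZeros_raiseIter hα u h).iterate_derivative u (by omega))

lemma hasOnlyPositiveZeros_raiseProd (ζ : ℕ → ℝ) (k : ℕ) (hζ : ∀ i ∈ Finset.Icc 1 k, 0 < ζ i) :
    HasOnlyPositiveZeros (raiseProd ζ k) := by
  induction k with
  | zero => exact hasOnlyPositiveZeros_one
  | succ k ih =>
    rw [raiseProd, ← neg_one_smul ℝ, hasOnlyPositiveZeros_smul (by norm_num)]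
    refine (ih fun i hi => hζ i ?_).raiseOp (hζ _ (by simp))
    rw [Finset.mem_Icc] at hi ⊢
    omega

lemma hasOnlyRealZeros_raiseProd_succ (ζ : ℕ → ℝ) (k : ℕ)
    (hζ : ∀ i ∈ Finset.Icc 1 k, 0 < ζ i) : HasOnlyRealZeros (raiseProd ζ (k + 1)) := by
  rw [raiseProd, ← neg_one_smul ℝ, hasOnlyRealZeros_smul (by norm_num)]
  exact (hasOnlyPositiveZeros_raiseProd ζ k hζ).hasOnlyRealZeros_raiseOp _

lemma add_shift_pos (x : ℝ) : 0 < x + shift x := by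
  have h1 : ((⌊-x + 1⌋ : ℤ) : ℝ) ≤ ((shift x : ℤ) : ℝ) := by
    rw [Int.cast_le, shift, Int.toNat_of_nonneg (le_max_left _ _)]
    exact le_max_right _ _
  have h2 := Int.lt_floor_add_one (-x + 1)
  rw [Int.cast_natCast] at h1
  linarith

lemma shift_eq_zero {x : ℝ} (hx : 0 < x) : shift x = 0 := by
  have : ⌊-x + 1⌋ < 1 := Int.floor_lt.2 (by push_cast; linarith)
  rw [shift, Int.toNat_eq_zero]
  omega

end LaguerreExpansion

end


theorem mainTheorem10 (α : ℝ) (hα : -1 < α) (K : ℕ) (hK : 1 ≤ K)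
    (τ : ℕ → ℝ) (hτ : τ K ≠ 0)
    (hR : LaguerreExpansion.HasOnlyRealZeros (LaguerreExpansion.polyR α K τ))
    -- `ζ 1 ≥ ζ 2 ≥ ⋯ ≥ ζ K` are the zeros of `R`, listed with multiplicity;
    -- the other values of `ζ` are arbitrary (`ζ 0` matters only in the case `K = 1`)
    (ζ : ℕ → ℝ) (hζ : AntitoneOn ζ (Set.Icc 1 K))
    (hroots : (LaguerreExpansion.polyR α K τ).roots = (Finset.Icc 1 K).val.map ζ) :
    LaguerreExpansion.HasOnlyRealZeros
        (LaguerreExpansion.expansion α K τ (LaguerreExpansion.shift (ζ (K - 1)))) ∧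
      LaguerreExpansion.HasOnlyPositiveZeros
        (LaguerreExpansion.expansion α K τ (LaguerreExpansion.shift (ζ K))) ∧
      (LaguerreExpansion.HasOnlyPositiveZeros (LaguerreExpansion.polyR α K τ) →
        LaguerreExpansion.shift (ζ K) = 0 ∧
          LaguerreExpansion.HasOnlyPositiveZeros
            (∑ j ∈ Finset.range (K + 1),
              Polynomial.C (τ j) * LaguerreExpansion.laguerre α j)) := by
  open LaguerreExpansion in
  have hpos : HasOnlyPositiveZeros (expansion α K τ (shift (ζ K))) := by
    obtain ⟨c, hc, h⟩ := sum_laguerre_eq_raiseProd α hK τ ζ hroots (shift (ζ K))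
    refine hasOnlyPositiveZeros_expansion hα K τ _ ?_
    rw [h, hasOnlyPositiveZeros_smul hc]
    refine hasOnlyPositiveZeros_raiseProd _ K fun i hi => ?_
    rw [Finset.mem_Icc] at hi
    have := hζ hi ⟨hK, le_rfl⟩ hi.2
    linarith [add_shift_pos (ζ K)]
  open LaguerreExpansion in
  refine ⟨?_, hpos, fun hR' => ?_⟩
  · obtain ⟨c, hc, h⟩ := sum_laguerre_eq_raiseProd α hK τ ζ hroots (shift (ζ (K - 1)))
    refine hasOnlyRealZeros_expansion hα K τ _ ?_
    rw [h, hasOnlyRealZeros_smul hc]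
    -- For `K = 1` this gives `k = 0`: no positivity is required, and `ζ 0` is harmless.
    obtain ⟨k, rfl⟩ := Nat.exists_eq_add_of_le' hK
    refine hasOnlyRealZeros_raiseProd_succ _ k fun i hi => ?_
    rw [Finset.mem_Icc] at hi
    rw [Nat.add_sub_cancel]
    have := hζ ⟨hi.1, by omega⟩ ⟨hi.1.trans hi.2, by omega⟩ hi.2
    linarith [add_shift_pos (ζ k)]
  · have hmem : ζ K ∈ (polyR α K τ).roots := by
      rw [hroots]
      exact Multiset.mem_map_of_mem ζ (Finset.mem_Icc.2 ⟨hK, le_rfl⟩)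
    have hz : 0 < ζ K := by
      have h0 : aeval (ζ K : ℂ) (polyR α K τ) = 0 := by
        rw [← Complex.coe_algebraMap, aeval_algebraMap_apply, coe_aeval_eq_eval,
          (mem_roots'.1 hmem).2, map_zero]
      exact (hR' _ h0).2
    refine ⟨shift_eq_zero hz, ?_⟩
    rw [shift_eq_zero hz] at hpos
    simpa [expansion, poch_zero] using hpos
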